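/- Let $u\in\mathbb{C}$ and let $v\neq 0$ be a real number such that $-u\notin\mathbb{N}+\frac{2iv}{\pi}\mathbb{N}$, where $\mathbb{N}=\{0,1,2,\dots\}$ (that is, $-u\neq m+\frac{2iv}{\pi}k$ for all integers $m,k\ge 0$). Then the power series $$\sum_{n\ge 0}\Gamma\Bigl(u+\frac{2ivn}{\pi}\Bigr)z^n$$ has the circle $|z|=e^{|v|}$ as its natural boundary: the series converges in the disc $|z|<e^{|v|}$, its sum $f$ is analytic there, and for no point $\zeta$ with $|\zeta|=e^{|v|}$ does there exist a function $g$, analytic in a neighbourhood of $\zeta$, such that $g(z)=f(z)$ for all $z$ in the disc sufficiently close to $\zeta$. -/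

import Mathlib

open Filter Topology

/-- The circle of center `0` and radius `R > 0` is a natural boundary of the power series
`∑ a n * z ^ n`: the series converges in the open disc of radius `R`, its sum is analytic there,
and no point `ζ` of the circle is regular, that is, there is no function `g` analytic in a
neighbourhood of `ζ` which agrees with the sum of the series at all points of the disc that are
close enough to `ζ`. -/
def CircleIsNaturalBoundary (a : ℕ → ℂ) (R : ℝ) : Prop :=
  0 < R ∧
  (∀ z ∈ Metric.ball (0 : ℂ) R, Summable fun n : ℕ => a n * z ^ n) ∧
  AnalyticOnNhd ℂ (fun z : ℂ => ∑' n : ℕ, a n * z ^ n) (Metric.ball (0 : ℂ) R) ∧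
  ∀ ζ ∈ Metric.sphere (0 : ℂ) R,
    ¬ ∃ g : ℂ → ℂ, AnalyticAt ℂ g ζ ∧
      ∀ᶠ z in 𝓝[Metric.ball (0 : ℂ) R] ζ, g z = ∑' n : ℕ, a n * z ^ n

/-! Suppose first that `Re u > 0`, and put `L = π² / |v|`, `q = exp L`. Poisson summation for `s ↦
exp (u L s - w exp (L s))`, whose Fourier transform is a Gamma integral, turns the lacunary series
`∑ q ^ (u k) exp (-w q ^ k)` over `k ∈ ℤ` into `L⁻¹ w ^ (-u) ∑ Γ(u + 2ivn/π) z ^ n` over `n ∈ ℤ`,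
where `z = w ^ (-2iv/π)` (`tsum_exp_sub_mul_exp_eq_powerSeries`). Since `|z| = exp (2v arg w / π)`,
the half-plane `Re w > 0` goes to the annulus `exp (-|v|) < |z| < exp |v|`, and one half of the
imaginary axis goes to the outer circle. The terms with `n < 0` are analytic across that circle, so
a regular point there would keep the lacunary series bounded near a point of the axis. It is
unbounded there: testing it on vertical segments against a bump times `exp (i q ^ m x)` isolates the
`m`-th term, of size `q ^ (m Re u)`, while the gaps between frequencies keep all the others bounded
in total (`exists_lt_norm_tsum_exp_sub_mul_exp`). For general `u`, the equation `Γ(s + 1) = s Γ(s)`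
says that the Euler operator `u + (2iv/π) z d/dz` maps the series for `u` to the one for `u + 1`. It
preserves regular points, so finitely many shifts reduce to `Re u > 0`. -/

/-! ### The Gamma integral with complex rate, and decay on vertical lines -/

open MeasureTheory Set in
theorem integrableOn_cpow_mul_cexp_neg_mul {a w : ℂ} (ha : 0 < a.re) (hw : 0 < w.re) :
    IntegrableOn (fun t : ℝ => (t : ℂ) ^ (a - 1) * Complex.exp (-(w * t))) (Ioi 0) := by
  have h := integrableOn_rpow_mul_exp_neg_mul_rpow (s := a.re - 1) (by linarith)
    (zero_lt_one' ℝ) hw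
  refine Integrable.mono' h ?_ ?_
  · refine ContinuousOn.aestronglyMeasurable (fun t ht => ?_) measurableSet_Ioi
    have h1 : ContinuousAt (fun t : ℝ => (t : ℂ) ^ (a - 1)) t :=
      ContinuousAt.cpow (by fun_prop) (by fun_prop) (by simpa using ht)
    exact (h1.mul (by fun_prop)).continuousWithinAt
  · refine (ae_restrict_mem measurableSet_Ioi).mono fun t ht => ?_
    rw [norm_mul, Complex.norm_cpow_eq_rpow_re_of_pos ht, Complex.norm_exp]
    simp

open MeasureTheory Set in
theorem differentiableAt_integral_cpow_mul_cexp_neg_mul {a w : ℂ} (ha : 0 < a.re)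
    (hw : 0 < w.re) :
    DifferentiableAt ℂ (fun w : ℂ =>
      ∫ t : ℝ in Ioi 0, (t : ℂ) ^ (a - 1) * Complex.exp (-(w * t))) w := by
  have hball : ∀ x ∈ Metric.ball w (w.re / 2), w.re / 2 < x.re := fun x hx => by
    have h1 := (Complex.abs_re_le_norm (x - w)).trans_lt (mem_ball_iff_norm.1 hx)
    rw [Complex.sub_re, abs_lt] at h1
    linarith
  have h := integrableOn_rpow_mul_exp_neg_mul_rpow (s := a.re) (by linarith)
    (zero_lt_one' ℝ) (half_pos hw)
  refine (hasDerivAt_integral_of_dominated_loc_of_deriv_le (s := Metric.ball w (w.re / 2))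
    (F := fun w (t : ℝ) => (t : ℂ) ^ (a - 1) * Complex.exp (-(w * t)))
    (F' := fun w (t : ℝ) => (t : ℂ) ^ (a - 1) * (Complex.exp (-(w * t)) * (-t)))
    (Metric.ball_mem_nhds w (half_pos hw)) ?_
    (integrableOn_cpow_mul_cexp_neg_mul ha hw) ?_ ?_ h ?_).2.differentiableAt
  · filter_upwards [Metric.ball_mem_nhds w (half_pos hw)] with x hx
    exact (integrableOn_cpow_mul_cexp_neg_mul ha
      ((half_pos hw).trans (hball x hx))).aestronglyMeasurable
  · have := (integrableOn_cpow_mul_cexp_neg_mul ha hw).aestronglyMeasurable.mul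
      (Continuous.aestronglyMeasurable (f := fun t : ℝ => -(t : ℂ)) (by fun_prop))
    refine this.congr (ae_of_all _ fun t => ?_)
    simp [mul_assoc]
  · refine (ae_restrict_mem measurableSet_Ioi).mono fun t (ht : 0 < t) x hx => ?_
    rw [norm_mul, norm_mul, Complex.norm_cpow_eq_rpow_re_of_pos ht, Complex.norm_exp, norm_neg,
      Complex.norm_real, Real.norm_of_nonneg ht.le, Real.rpow_one, mul_left_comm,
      mul_comm (Real.exp _)]
    rw [Complex.sub_re, Complex.one_re, ← Real.rpow_add_one ht.ne', sub_add_cancel]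
    refine mul_le_mul_of_nonneg_left (Real.exp_le_exp.2 ?_) (Real.rpow_nonneg ht.le _)
    simp only [Complex.neg_re, Complex.re_mul_ofReal, neg_mul]
    exact neg_le_neg (mul_le_mul_of_nonneg_right (hball x hx).le ht.le)
  · refine ae_of_all _ fun t x hx => ?_
    refine HasDerivAt.const_mul _ (HasDerivAt.cexp ?_)
    have h1 := ((hasDerivAt_id x).mul_const (t : ℂ)).fun_neg
    rwa [one_mul] at h1

-- Both sides are analytic in `w` on the right half-plane and agree for real `w > 0`, so the
-- identity theorem applies.
open MeasureTheory Set in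
theorem integral_cpow_mul_cexp_neg_mul {a w : ℂ} (ha : 0 < a.re) (hw : 0 < w.re) :
    ∫ t : ℝ in Ioi 0, (t : ℂ) ^ (a - 1) * Complex.exp (-(w * t)) =
      Complex.exp (-(a * Complex.log w)) * Complex.Gamma a := by
  have hopen : IsOpen {w : ℂ | 0 < w.re} := isOpen_lt continuous_const Complex.continuous_re
  have h1 : AnalyticOnNhd ℂ (fun w : ℂ =>
      ∫ t : ℝ in Ioi 0, (t : ℂ) ^ (a - 1) * Complex.exp (-(w * t))) {w : ℂ | 0 < w.re} :=
    DifferentiableOn.analyticOnNhd (fun x hx =>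
      (differentiableAt_integral_cpow_mul_cexp_neg_mul ha hx).differentiableWithinAt) hopen
  have h2 : AnalyticOnNhd ℂ (fun w : ℂ => Complex.exp (-(a * Complex.log w)) * Complex.Gamma a)
      {w : ℂ | 0 < w.re} :=
    DifferentiableOn.analyticOnNhd (fun x hx => by
      have : DifferentiableAt ℂ Complex.log x := Complex.differentiableAt_log (Or.inl hx)
      exact DifferentiableAt.differentiableWithinAt (by fun_prop)) hopen
  refine h1.eqOn_of_preconnected_of_frequently_eq h2
    (convex_halfSpace_re_gt 0).isPreconnected (z₀ := 1) (by simp) ?_ hw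
  have hev : ∀ᶠ r : ℝ in 𝓝[≠] 1, (∫ t : ℝ in Ioi 0, (t : ℂ) ^ (a - 1) *
      Complex.exp (-((r : ℂ) * t)) = Complex.exp (-(a * Complex.log r)) * Complex.Gamma a) := by
    filter_upwards [nhdsWithin_le_nhds (lt_mem_nhds zero_lt_one)] with r hr
    rw [Complex.integral_cpow_mul_exp_neg_mul_Ioi ha hr, one_div,
      Complex.inv_cpow _ _ (by rw [Complex.arg_ofReal_of_nonneg hr.le]; exact Real.pi_pos.ne),
      ← Complex.cpow_neg, Complex.cpow_def_of_ne_zero (by exact_mod_cast hr.ne')]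
    ring_nf
  have ht : Tendsto (fun r : ℝ => (r : ℂ)) (𝓝[≠] 1) (𝓝[≠] 1) := by
    refine tendsto_nhdsWithin_of_tendsto_nhds_of_eventually_within _ ?_ ?_
    · exact ((Complex.continuous_ofReal.tendsto 1).mono_left nhdsWithin_le_nhds)
    · filter_upwards [self_mem_nhdsWithin] with r hr
      simpa using hr
  exact ht.frequently hev.frequently

/-- Exponential decay of `Γ` on vertical lines. -/
theorem exists_norm_Gamma_le {u : ℂ} (hu : 0 < u.re) {φ : ℝ} (hφ : φ ∈ Set.Ioo 0 (Real.pi / 2)) :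
    ∃ C : ℝ, ∀ t : ℝ, ‖Complex.Gamma (u + t * Complex.I)‖ ≤ C * Real.exp (-(φ * |t|)) := by
  -- With `w = exp (iψ)` the integral is bounded independently of `t`, while `w ^ (-a)` contributes
  -- the factor `exp (ψ (Im u + t))`. The two signs of `ψ` serve the two signs of `t`.
  have key : ∀ ψ ∈ Set.Ioo (-(Real.pi / 2)) (Real.pi / 2), ∃ C : ℝ, ∀ t : ℝ,
      ‖Complex.Gamma (u + t * Complex.I)‖ ≤ C * Real.exp (-(ψ * t)) := fun ψ hψ => by
    set w : ℂ := Complex.exp (ψ * Complex.I) with hw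
    have hwre : 0 < w.re := by
      rw [hw, Complex.exp_ofReal_mul_I_re]
      exact Real.cos_pos_of_mem_Ioo hψ
    have hlog : Complex.log w = ψ * Complex.I := Complex.log_exp (by
      simp; linarith [hψ.1, Real.pi_pos]) (by simp; linarith [hψ.2, Real.pi_pos])
    set M := ∫ t : ℝ in Set.Ioi 0, t ^ (u.re - 1) * Real.exp (-w.re * t ^ (1 : ℝ))
    refine ⟨M * Real.exp (-(ψ * u.im)), fun t => ?_⟩
    have ha : 0 < (u + t * Complex.I).re := by simpa using hu
    have h1 := integral_cpow_mul_cexp_neg_mul ha hwre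
    have h2 : ‖Complex.exp (-((u + t * Complex.I) * Complex.log w)) *
        Complex.Gamma (u + t * Complex.I)‖ ≤ M := by
      rw [← h1]
      refine (MeasureTheory.norm_integral_le_integral_norm _).trans_eq ?_
      refine MeasureTheory.setIntegral_congr_fun measurableSet_Ioi fun t ht => ?_
      rw [norm_mul, Complex.norm_cpow_eq_rpow_re_of_pos ht, Complex.norm_exp]
      simp
    rw [norm_mul, Complex.norm_exp, hlog] at h2
    have h3 : (-((u + t * Complex.I) * (ψ * Complex.I))).re = ψ * (u.im + t) := by
      simp; ring
    rw [h3] at h2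
    rw [mul_assoc, ← Real.exp_add, show -(ψ * u.im) + -(ψ * t) = -(ψ * (u.im + t)) by ring,
      Real.exp_neg, ← div_eq_mul_inv, le_div_iff₀ (Real.exp_pos _), mul_comm]
    exact h2
  obtain ⟨C₁, h₁⟩ := key φ ⟨by linarith [hφ.1, hφ.2], hφ.2⟩
  obtain ⟨C₂, h₂⟩ := key (-φ) ⟨by linarith [hφ.1, hφ.2], by linarith [hφ.1, hφ.2]⟩
  refine ⟨max C₁ C₂, fun t => ?_⟩
  rcases le_total 0 t with ht | ht
  · rw [abs_of_nonneg ht]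
    exact (h₁ t).trans (mul_le_mul_of_nonneg_right (le_max_left _ _) (Real.exp_pos _).le)
  · rw [abs_of_nonpos ht]
    refine (h₂ t).trans ?_
    rw [neg_mul, mul_neg]
    exact mul_le_mul_of_nonneg_right (le_max_right _ _) (Real.exp_pos _).le

/-! ### Power series with geometrically bounded coefficients -/

/-- The coefficients `a n` are bounded by a multiple of `r⁻¹ ^ n` for each `0 < r < R`. -/
def CoeffBound (a : ℕ → ℂ) (R : ℝ) : Prop :=
  ∀ r : ℝ, 0 < r → r < R → ∃ C : ℝ, ∀ n, ‖a n‖ * r ^ n ≤ C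

theorem CoeffBound.summable {a : ℕ → ℂ} {R : ℝ} (h : CoeffBound a R) {r : ℝ} (hr : 0 < r)
    (hrR : r < R) : Summable fun n => ‖a n‖ * r ^ n := by
  obtain ⟨s, hs, hsR⟩ := exists_between hrR
  have hs0 := hr.trans hs
  obtain ⟨C, hC⟩ := h s hs0 hsR
  refine Summable.of_nonneg_of_le (fun n => by positivity) (fun n => ?_)
    ((summable_geometric_of_lt_one (div_nonneg hr.le hs0.le) ((div_lt_one hs0).2 hs)).mul_left C)
  calc ‖a n‖ * r ^ n = ‖a n‖ * s ^ n * (r / s) ^ n := by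
        rw [mul_assoc, ← mul_pow, mul_div_cancel₀ _ hs0.ne']
    _ ≤ C * (r / s) ^ n := mul_le_mul_of_nonneg_right (hC n) (by positivity)

theorem exists_radius_of_mem_ball {z : ℂ} {R : ℝ} (hz : z ∈ Metric.ball (0 : ℂ) R) :
    ∃ r : ℝ, 0 < r ∧ r < R ∧ z ∈ Metric.ball (0 : ℂ) r := by
  rw [mem_ball_zero_iff] at hz
  obtain ⟨r, h1, h2⟩ := exists_between hz
  exact ⟨r, (norm_nonneg z).trans_lt h1, h2, by simpa using h1⟩

theorem norm_mul_pow_le_of_mem_ball (a : ℕ → ℂ) {r : ℝ} (n : ℕ) (z : ℂ)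
    (hz : z ∈ Metric.ball (0 : ℂ) r) : ‖a n * z ^ n‖ ≤ ‖a n‖ * r ^ n := by
  rw [norm_mul, norm_pow]
  gcongr
  exact (mem_ball_zero_iff.1 hz).le

theorem CoeffBound.summable_ball {a : ℕ → ℂ} {R : ℝ} (h : CoeffBound a R) {z : ℂ}
    (hz : z ∈ Metric.ball (0 : ℂ) R) : Summable fun n => a n * z ^ n := by
  obtain ⟨r, hr, hrR, hzr⟩ := exists_radius_of_mem_ball hz
  exact .of_norm_bounded (h.summable hr hrR) fun n => norm_mul_pow_le_of_mem_ball a n z hzr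

theorem CoeffBound.analyticOnNhd {a : ℕ → ℂ} {R : ℝ} (h : CoeffBound a R) :
    AnalyticOnNhd ℂ (fun z : ℂ => ∑' n : ℕ, a n * z ^ n) (Metric.ball (0 : ℂ) R) := fun z hz => by
  obtain ⟨r, hr, hrR, hzr⟩ := exists_radius_of_mem_ball hz
  exact (Complex.differentiableOn_tsum_of_summable_norm (h.summable hr hrR)
    (fun n => by fun_prop) Metric.isOpen_ball
    (norm_mul_pow_le_of_mem_ball a)).analyticOnNhd Metric.isOpen_ball z hzr

/-- Termwise application of the Euler operator `c + d z ∂/∂z`. -/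
theorem CoeffBound.tsum_euler {a : ℕ → ℂ} {R : ℝ} (h : CoeffBound a R) (c d : ℂ) {z : ℂ}
    (hz : z ∈ Metric.ball (0 : ℂ) R) :
    ∑' n : ℕ, (c + d * n) * a n * z ^ n =
      c * ∑' n : ℕ, a n * z ^ n + d * z * deriv (fun z : ℂ => ∑' n : ℕ, a n * z ^ n) z := by
  obtain ⟨r, hr, hrR, hzr⟩ := exists_radius_of_mem_ball hz
  have h1 := Complex.hasSum_deriv_of_summable_norm (h.summable hr hrR)
    (fun n => by fun_prop) Metric.isOpen_ball (norm_mul_pow_le_of_mem_ball a) hzr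
  rw [← ((h.summable_ball hz).hasSum.mul_left c |>.add (h1.mul_left (d * z))).tsum_eq]
  refine tsum_congr fun n => ?_
  have h2 : deriv (fun w : ℂ => a n * w ^ n) z = a n * (n * z ^ (n - 1)) := by simp
  rw [h2]
  rcases n with _ | n
  · simp
  · rw [Nat.add_sub_cancel, pow_succ]
    ring

/-! ### The Gamma coefficients and the shift from `u` to `u + 1` -/

/-- The coefficients `Γ(u + 2ivn/π)`. -/
noncomputable def gammaCoeff (u : ℂ) (v : ℝ) (n : ℕ) : ℂ :=
  Complex.Gamma (u + 2 * Complex.I * (v : ℂ) * (n : ℂ) / (Real.pi : ℂ))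

theorem gammaCoeff_arg (u : ℂ) (v : ℝ) (t : ℂ) :
    u + 2 * Complex.I * (v : ℂ) * t / (Real.pi : ℂ) = u + 2 * v / Real.pi * t * Complex.I := by
  ring

theorem exists_norm_Gamma_mul_pow_le {u : ℂ} (hu : 0 < u.re) {v r : ℝ} (hr : 1 < r)
    (hrv : r < Real.exp |v|) :
    ∃ C : ℝ, ∀ t : ℝ, ‖Complex.Gamma (u + 2 * v / Real.pi * t * Complex.I)‖ *
      r ^ |t| ≤ C := by
  have hr0 : 0 < r := by linarith
  have hlog : 0 < Real.log r := Real.log_pos hr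
  have hlv : Real.log r < |v| := (Real.log_lt_iff_lt_exp hr0).2 hrv
  have hv : 0 < |v| := hlog.trans hlv
  have hpi := Real.pi_pos
  -- This angle makes the decay at height `2vt/π` exactly `r ^ (-|t|)`; it is below `π/2` because
  -- `log r < |v|`.
  obtain ⟨C, hC⟩ := exists_norm_Gamma_le hu (φ := Real.pi / 2 * (Real.log r / |v|))
    ⟨by positivity, by
      have := (div_lt_one hv).2 hlv
      nlinarith⟩
  refine ⟨C, fun t => ?_⟩
  have h := hC (2 * v / Real.pi * t)
  rw [abs_mul, abs_div, abs_mul, abs_two, abs_of_pos hpi] at h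
  have h2 : Real.pi / 2 * (Real.log r / |v|) * (2 * |v| / Real.pi * |t|) = Real.log r * |t| := by
    field_simp
  rw [h2, Real.exp_neg, ← Real.rpow_def_of_pos hr0, ← div_eq_mul_inv,
    le_div_iff₀ (Real.rpow_pos_of_pos hr0 _)] at h
  push_cast at h
  exact h

theorem CoeffBound.of_one_lt {a : ℕ → ℂ} {R : ℝ} (hR : 1 < R)
    (h : ∀ r, 1 < r → r < R → ∃ C : ℝ, ∀ n, ‖a n‖ * r ^ n ≤ C) : CoeffBound a R := by
  intro r hr hrR
  obtain ⟨s, hs, hsR⟩ := exists_between (max_lt hR hrR)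
  obtain ⟨C, hC⟩ := h s ((le_max_left _ _).trans_lt hs) hsR
  refine ⟨C, fun n => le_trans ?_ (hC n)⟩
  gcongr
  exact (le_max_right _ _).trans hs.le

theorem coeffBound_gammaCoeff_of_re_pos {u : ℂ} (hu : 0 < u.re) {v : ℝ} (hv : v ≠ 0) :
    CoeffBound (gammaCoeff u v) (Real.exp |v|) := by
  refine CoeffBound.of_one_lt (Real.one_lt_exp_iff.2 (abs_pos.2 hv)) fun r hr hrR => ?_
  obtain ⟨C, hC⟩ := exists_norm_Gamma_mul_pow_le hu hr hrR
  refine ⟨C, fun n => ?_⟩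
  have := hC n
  rwa [abs_of_nonneg (Nat.cast_nonneg n), Real.rpow_natCast, Complex.ofReal_natCast,
    ← gammaCoeff_arg] at this

/-- None of the arguments `u + 2ivn/π` and their shifts by natural numbers is zero. -/
def AvoidsPoles (u : ℂ) (v : ℝ) : Prop :=
  ∀ m k : ℕ, -u ≠ (m : ℂ) + (2 * Complex.I * (v : ℂ) / (Real.pi : ℂ)) * (k : ℂ)

theorem AvoidsPoles.add_one {u : ℂ} {v : ℝ} (h : AvoidsPoles u v) : AvoidsPoles (u + 1) v :=
  fun m k hmk => h (m + 1) k (by push_cast; linear_combination hmk)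

theorem AvoidsPoles.ne_zero {u : ℂ} {v : ℝ} (h : AvoidsPoles u v) (n : ℕ) :
    u + 2 * Complex.I * (v : ℂ) / Real.pi * n ≠ 0 := fun h0 =>
  h 0 n (by push_cast; linear_combination -h0)

theorem AvoidsPoles.gammaCoeff_add_one {u : ℂ} {v : ℝ} (h : AvoidsPoles u v) (n : ℕ) :
    gammaCoeff (u + 1) v n = (u + 2 * Complex.I * (v : ℂ) / Real.pi * n) * gammaCoeff u v n := by
  have h1 := Complex.Gamma_add_one _ (h.ne_zero n)
  unfold gammaCoeff
  rw [show u + 1 + 2 * Complex.I * (v : ℂ) * (n : ℂ) / (Real.pi : ℂ) =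
    u + 2 * Complex.I * (v : ℂ) / Real.pi * n + 1 by ring, h1]
  congr 2
  ring

/-- The norms tend to infinity, and the finitely many remaining ones are nonzero. -/
theorem AvoidsPoles.exists_le_norm {u : ℂ} {v : ℝ} (hv : v ≠ 0) (h : AvoidsPoles u v) :
    ∃ c : ℝ, 0 < c ∧ ∀ n : ℕ, c ≤ ‖u + 2 * Complex.I * (v : ℂ) / Real.pi * n‖ := by
  have hd : 0 < ‖2 * Complex.I * (v : ℂ) / Real.pi‖ := by
    simp [hv, Real.pi_ne_zero]
  have ht : Tendsto (fun n : ℕ => ‖u + 2 * Complex.I * (v : ℂ) / Real.pi * n‖) atTop atTop := by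
    have h1 : Tendsto (fun n : ℕ => ‖2 * Complex.I * (v : ℂ) / Real.pi‖ * n - ‖u‖) atTop atTop :=
      tendsto_atTop_add_const_right _ _ (tendsto_natCast_atTop_atTop.const_mul_atTop hd)
    refine tendsto_atTop_mono (fun n => ?_) h1
    have := norm_sub_norm_le (2 * Complex.I * (v : ℂ) / Real.pi * n) (-u)
    rwa [norm_mul, norm_neg, Complex.norm_natCast, sub_neg_eq_add, add_comm _ u] at this
  obtain ⟨N, hN⟩ := (ht.eventually_ge_atTop 1).exists_forall_of_atTop
  have hfin : ∃ c : ℝ, 0 < c ∧ ∀ n < N, c ≤ ‖u + 2 * Complex.I * (v : ℂ) / Real.pi * n‖ := by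
    clear hN
    induction N with
    | zero => exact ⟨1, one_pos, fun n hn => absurd hn (Nat.not_lt_zero n)⟩
    | succ N ih =>
      obtain ⟨c, hc, hcn⟩ := ih
      refine ⟨min c ‖u + 2 * Complex.I * (v : ℂ) / Real.pi * N‖,
        lt_min hc (norm_pos_iff.2 (h.ne_zero N)), fun n hn => ?_⟩
      rcases Nat.lt_succ_iff_lt_or_eq.1 hn with hn | rfl
      · exact (min_le_left _ _).trans (hcn n hn)
      · exact min_le_right _ _
  obtain ⟨c, hc, hcn⟩ := hfin
  refine ⟨min c 1, lt_min hc one_pos, fun n => ?_⟩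
  rcases lt_or_ge n N with hn | hn
  · exact (min_le_left _ _).trans (hcn n hn)
  · exact (min_le_right _ _).trans (hN n hn)

theorem AvoidsPoles.coeffBound_of_add_one {u : ℂ} {v : ℝ} (hv : v ≠ 0) (h : AvoidsPoles u v)
    {R : ℝ} (h1 : CoeffBound (gammaCoeff (u + 1) v) R) : CoeffBound (gammaCoeff u v) R := by
  intro r hr hrR
  obtain ⟨C, hC⟩ := h1 r hr hrR
  obtain ⟨c, hc, hcn⟩ := h.exists_le_norm hv
  refine ⟨C / c, fun n => (le_div_iff₀ hc).2 (le_trans ?_ (hC n))⟩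
  rw [h.gammaCoeff_add_one, norm_mul, mul_comm, mul_assoc]
  exact mul_le_mul_of_nonneg_right (hcn n) (by positivity)

theorem AvoidsPoles.induction {v : ℝ} {P : ℂ → Prop} (h0 : ∀ u : ℂ, 0 < u.re → P u)
    (h1 : ∀ u : ℂ, AvoidsPoles u v → P (u + 1) → P u) {u : ℂ} (hu : AvoidsPoles u v) : P u := by
  obtain ⟨N, hN⟩ := exists_nat_gt (-u.re)
  induction N generalizing u with
  | zero => exact h0 u (by simpa using hN)
  | succ N ih =>
    refine h1 u hu (ih hu.add_one ?_)
    push_cast at hN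
    simp
    linarith

theorem AvoidsPoles.coeffBound {u : ℂ} {v : ℝ} (hv : v ≠ 0) (h : AvoidsPoles u v) :
    CoeffBound (gammaCoeff u v) (Real.exp |v|) :=
  AvoidsPoles.induction (fun _ hu => coeffBound_gammaCoeff_of_re_pos hu hv)
    (fun _ hu h1 => hu.coeffBound_of_add_one hv h1) h

/-! ### The lacunary series near the imaginary axis -/

theorem summable_exp_neg_mul_abs_int {κ : ℝ} (hκ : 0 < κ) :
    Summable fun k : ℤ => Real.exp (-(κ * |(k : ℝ)|)) := by
  have h : Summable fun n : ℕ => Real.exp (-(κ * n)) := by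
    have := Real.summable_exp_nat_mul_iff.2 (neg_lt_zero.2 hκ)
    refine this.congr fun n => ?_
    ring_nf
  refine Summable.of_nat_of_neg ?_ ?_ <;> simpa using h

/-- For `x ≥ 0`, one term of the exponential series gives `exp (-c exp x) ≤ N! / (c exp x) ^ N`, and
`N ≥ 2σ` turns growth into decay. For `x ≤ 0` the factor `exp (σ x)` already suffices. -/
theorem exp_sub_mul_exp_le {σ c : ℝ} (hc : 0 < c) :
    ∃ K : ℝ, 0 < K ∧ ∀ x : ℝ, Real.exp (σ * x - c * Real.exp x) ≤ K * Real.exp (-(σ * |x|)) := by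
  obtain ⟨N, hN⟩ := exists_nat_ge (2 * σ)
  refine ⟨max 1 (N.factorial / c ^ N), by positivity, fun x => ?_⟩
  rcases le_total x 0 with hx | hx
  · rw [abs_of_nonpos hx]
    refine le_trans (Real.exp_le_exp.2 ?_)
      (le_mul_of_one_le_left (Real.exp_pos _).le (le_max_left _ _))
    have := mul_pos hc (Real.exp_pos x)
    linarith
  · rw [abs_of_nonneg hx]
    refine le_trans ?_ (mul_le_mul_of_nonneg_right (le_max_right _ _) (Real.exp_pos _).le)
    have h1 := Real.pow_div_factorial_le_exp (c * Real.exp x) (by positivity) N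
    have h2 : Real.exp (-(c * Real.exp x)) ≤ N.factorial / (c ^ N * Real.exp (N * x)) := by
      rw [Real.exp_nat_mul, ← mul_pow, Real.exp_neg, ← inv_div]
      exact inv_anti₀ (by positivity) h1
    rw [sub_eq_add_neg, Real.exp_add]
    calc Real.exp (σ * x) * Real.exp (-(c * Real.exp x))
        ≤ Real.exp (σ * x) * (N.factorial / (c ^ N * Real.exp (N * x))) := by gcongr
      _ = N.factorial / c ^ N * (Real.exp (σ * x) * Real.exp (-(N * x))) := by
        rw [Real.exp_neg]; field_simp
      _ ≤ N.factorial / c ^ N * Real.exp (-(σ * x)) := by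
        rw [← Real.exp_add]
        gcongr
        nlinarith

/-- Distinct powers of `exp L` differ by at least `1 - exp (-L)` times the larger one, whose index
is at least `max k 0` because `m ≥ 0`. -/
theorem le_abs_exp_sub_exp {L : ℝ} (hL : 0 < L) {k m : ℤ} (hm : 0 ≤ m) (hkm : k ≠ m) :
    (1 - Real.exp (-L)) * Real.exp (L * max (k : ℝ) 0) ≤
      |Real.exp (L * k) - Real.exp (L * m)| := by
  have h1 : 0 < 1 - Real.exp (-L) := sub_pos.2 (Real.exp_lt_one_iff.2 (neg_lt_zero.2 hL))
  have key : ∀ i j : ℤ, i < j →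
      (1 - Real.exp (-L)) * Real.exp (L * j) ≤ Real.exp (L * j) - Real.exp (L * i) := by
    intro i j hij
    have hij' : (i : ℝ) + 1 ≤ j := by exact_mod_cast hij
    rw [sub_mul, one_mul, ← Real.exp_add]
    refine sub_le_sub_left (Real.exp_le_exp.2 ?_) _
    nlinarith
  have hm' : (0 : ℝ) ≤ m := by exact_mod_cast hm
  rcases lt_or_gt_of_ne hkm with h | h
  · rw [abs_sub_comm]
    refine le_trans ?_ ((key k m h).trans (le_abs_self _))
    gcongr
    exact max_le (by exact_mod_cast h.le) hm'
  · refine le_trans ?_ ((key m k h).trans (le_abs_self _))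
    gcongr
    exact max_le le_rfl (hm'.trans (by exact_mod_cast h.le))

/-- Rapid decay of the Fourier integrals of a smooth bump function. -/
theorem ContDiffBump.exists_abs_pow_mul_norm_integral_le {y : ℝ} (φ : ContDiffBump y) (N : ℕ) :
    ∃ C : ℝ, 0 < C ∧ ∀ ξ : ℝ, |ξ| ^ N *
      ‖∫ x : ℝ, (φ x : ℂ) * Complex.exp (-(Complex.I * ξ * x))‖ ≤ C := by
  have hc : HasCompactSupport (fun x : ℝ => (φ x : ℂ)) :=
    φ.hasCompactSupport.comp_left Complex.ofReal_zero
  have hs : ContDiff ℝ (⊤ : ℕ∞) (fun x : ℝ => (φ x : ℂ)) :=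
    Complex.ofRealCLM.contDiff.comp φ.contDiff
  obtain ⟨C, hC0, hC⟩ := (FourierTransform.fourier (hc.toSchwartzMap hs)).decay N 0
  refine ⟨(2 * Real.pi) ^ N * C, by positivity, fun ξ => ?_⟩
  have h := hC (ξ / (2 * Real.pi))
  rw [norm_iteratedFDeriv_zero, SchwartzMap.fourier_coe,
    Real.fourier_real_eq_integral_exp_smul, Real.norm_eq_abs, abs_div,
    abs_of_pos Real.two_pi_pos, div_pow, div_mul_eq_mul_div,
    div_le_iff₀ (by positivity), mul_comm C] at h
  refine le_trans (le_of_eq ?_) h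
  congr 3
  funext x
  rw [smul_eq_mul, mul_comm]
  congr 2
  push_cast
  have := Real.pi_ne_zero
  field_simp

/-- The lacunary series `∑ q ^ (u k) exp (-w q ^ k)` with `q = exp L > 1` is unbounded near each
point of the imaginary axis. -/
theorem exists_lt_norm_tsum_exp_sub_mul_exp {u : ℂ} (hu : 0 < u.re) {L : ℝ} (hL : 0 < L) (y : ℝ)
    {δ : ℝ} (hδ : 0 < δ) (M : ℝ) :
    ∃ w : ℂ, 0 < w.re ∧ ‖w - y * Complex.I‖ < δ ∧
      M < ‖∑' k : ℤ, Complex.exp (u * L * k - w * Real.exp (L * k))‖ := by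
  by_contra! hM
  obtain ⟨N, hN⟩ := exists_nat_ge (2 * u.re)
  let φ : ContDiffBump y := ⟨δ / 4, δ / 2, by linarith, by linarith⟩
  obtain ⟨C, hC0, hC⟩ := φ.exists_abs_pow_mul_norm_integral_le N
  have hφint : MeasureTheory.Integrable (fun x => φ x) := φ.integrable
  have hc : 0 < ∫ x, φ x := φ.integral_pos
  set c := ∫ x, φ x with hcdef
  have hq : 0 < 1 - Real.exp (-L) := sub_pos.2 (Real.exp_lt_one_iff.2 (neg_lt_zero.2 hL))
  set D := C / (1 - Real.exp (-L)) ^ N with hD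
  have hS := summable_exp_neg_mul_abs_int (mul_pos hu hL)
  set S := ∑' k : ℤ, Real.exp (-(u.re * L * |(k : ℝ)|))
  have key : ∀ m : ℕ, Real.exp (-(L * m)) < δ / 2 →
      Real.exp (u.re * L * m - 1) * c ≤ M * c + D * S := by
    intro m hm
    -- On the line `Re w = ε` the damping costs the `m`-th term only a factor `exp (-1)`.
    set ε := Real.exp (-(L * m)) with hε
    have hε0 : 0 < ε := Real.exp_pos _
    have hεm : ε * Real.exp (L * m) = 1 := by rw [hε, ← Real.exp_add]; simp
    -- `K` depends on `m`, but serves only to exchange sum and integral; the final bound `D * S`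
    -- does not involve it.
    obtain ⟨K, hK0, hK⟩ := exp_sub_mul_exp_le (σ := u.re) hε0
    let F : ℤ → ℝ → ℂ := fun k x => (φ x : ℂ) * (Complex.exp (Complex.I * Real.exp (L * m) * x) *
      Complex.exp (u * L * k - (ε + x * Complex.I) * Real.exp (L * k)))
    have hφcont : Continuous fun x => φ x := φ.continuous
    have hFnorm : ∀ k x, ‖F k x‖ = φ x * Real.exp (u.re * (L * k) - ε * Real.exp (L * k)) := by
      intro k x
      simp only [F]
      rw [norm_mul, norm_mul, Complex.norm_exp, Complex.norm_exp, Complex.norm_real,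
        Real.norm_of_nonneg φ.nonneg]
      have h1 : (Complex.I * Real.exp (L * m) * x).re = 0 := by
        rw [Complex.re_mul_ofReal, Complex.re_mul_ofReal]; simp
      have h2 : (u * L * k - (ε + x * Complex.I) * Real.exp (L * k)).re =
          u.re * (L * k) - ε * Real.exp (L * k) := by
        rw [Complex.sub_re, Complex.re_mul_ofReal, mul_assoc,
          show (L : ℂ) * (k : ℂ) = ((L * k : ℝ) : ℂ) by push_cast; ring, Complex.re_mul_ofReal]
        simp
      rw [h1, h2, Real.exp_zero, one_mul]
    have hFint : ∀ k, MeasureTheory.Integrable (F k) := fun k => by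
      refine (hφint.mul_const (Real.exp (u.re * (L * k) - ε * Real.exp (L * k)))).mono'
        (Continuous.aestronglyMeasurable ?_) (Eventually.of_forall fun x => (hFnorm k x).le)
      fun_prop
    have hFsum : Summable fun k => ∫ x, ‖F k x‖ := by
      refine Summable.of_nonneg_of_le (fun k => by positivity) (fun k => ?_)
        (hS.mul_left (c * K))
      simp_rw [hFnorm]
      rw [MeasureTheory.integral_mul_const, mul_assoc]
      refine mul_le_mul_of_nonneg_left ((hK _).trans_eq ?_) hc.le
      rw [abs_mul, abs_of_pos hL, mul_assoc]
    have hsum := MeasureTheory.hasSum_integral_of_summable_integral_norm hFint hFsum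
    have hT : ‖∫ x, ∑' k, F k x‖ ≤ M * c := by
      rw [hcdef, ← MeasureTheory.integral_const_mul]
      refine MeasureTheory.norm_integral_le_of_norm_le (hφint.const_mul M)
        (Eventually.of_forall fun x => ?_)
      simp only [F]
      rw [tsum_mul_left, tsum_mul_left, norm_mul, norm_mul, Complex.norm_real,
        Real.norm_of_nonneg φ.nonneg, Complex.norm_exp, mul_comm M]
      have h1 : (Complex.I * Real.exp (L * m) * x).re = 0 := by
        rw [Complex.re_mul_ofReal, Complex.re_mul_ofReal]; simp
      rw [h1, Real.exp_zero, one_mul]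
      by_cases hx : x ∈ Metric.ball y (δ / 2)
      · refine mul_le_mul_of_nonneg_left (hM _ (by simpa using hε0) ?_) φ.nonneg
        rw [show (ε : ℂ) + x * Complex.I - y * Complex.I = ε + ((x - y : ℝ) : ℂ) * Complex.I by
          push_cast; ring]
        refine (norm_add_le _ _).trans_lt ?_
        rw [norm_mul, Complex.norm_I, mul_one, Complex.norm_real, Complex.norm_real,
          Real.norm_of_nonneg hε0.le, ← dist_eq_norm]
        have := Metric.mem_ball.1 hx
        linarith
      · have h0 : φ x = 0 := φ.zero_of_le_dist (by simpa using hx)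
        rw [h0, zero_mul, zero_mul]
    have hFk : ∀ k : ℤ, ∫ x, F k x = Complex.exp (u * L * k - ε * Real.exp (L * k)) *
        ∫ x : ℝ, (φ x : ℂ) *
          Complex.exp (-(Complex.I * (Real.exp (L * k) - Real.exp (L * m) : ℝ) * x)) := by
      intro k
      rw [← MeasureTheory.integral_const_mul]
      refine MeasureTheory.integral_congr_ae (Eventually.of_forall fun x => ?_)
      simp only [F]
      rw [← Complex.exp_add, mul_left_comm (Complex.exp _) (φ x : ℂ), ← Complex.exp_add]
      congr 2
      push_cast
      ring
    have hre : ∀ k : ℤ, ‖Complex.exp (u * L * k - ε * Real.exp (L * k))‖ =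
        Real.exp (u.re * L * k - ε * Real.exp (L * k)) := by
      intro k
      rw [Complex.norm_exp, Complex.sub_re, Complex.re_mul_ofReal, mul_assoc,
          show (L : ℂ) * (k : ℂ) = ((L * k : ℝ) : ℂ) by push_cast; ring, Complex.re_mul_ofReal]
      simp [mul_assoc]
    have hFm : ‖∫ x, F m x‖ = Real.exp (u.re * L * m - 1) * c := by
      rw [hFk, norm_mul, hre]
      simp only [Int.cast_natCast, sub_self, Complex.ofReal_zero, mul_zero, zero_mul, neg_zero,
        Complex.exp_zero, mul_one]
      rw [integral_complex_ofReal, Complex.norm_real, Real.norm_of_nonneg hc.le, hεm]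
    -- For `k > 0`, the Fourier decay of order `N ≥ 2 Re u` beats the growth `exp (L k Re u)`; for
    -- `k ≤ 0` that factor itself decays.
    have hFle : ∀ k : ℤ, k ≠ m → ‖∫ x, F k x‖ ≤ D * Real.exp (-(u.re * L * |(k : ℝ)|)) := by
      intro k hk
      set ξ := Real.exp (L * k) - Real.exp (L * m) with hξ
      have hgap := le_abs_exp_sub_exp hL (Int.natCast_nonneg m) hk
      rw [Int.cast_natCast, ← hξ] at hgap
      have hlow : 0 < (1 - Real.exp (-L)) * Real.exp (L * max (k : ℝ) 0) := by positivity
      have hΦ := hC ξ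
      set Φ := ‖∫ x : ℝ, (φ x : ℂ) * Complex.exp (-(Complex.I * ξ * x))‖
      have hΦ2 : Φ ≤ D * Real.exp (-(N * (L * max (k : ℝ) 0))) := by
        have h1 : ((1 - Real.exp (-L)) * Real.exp (L * max (k : ℝ) 0)) ^ N * Φ ≤ C :=
          (mul_le_mul_of_nonneg_right (pow_le_pow_left₀ hlow.le hgap N)
            (norm_nonneg _)).trans hΦ
        rw [mul_pow, ← Real.exp_nat_mul, mul_comm, ← le_div_iff₀ (by positivity)] at h1
        refine h1.trans_eq ?_
        rw [hD, Real.exp_neg (N * _), ← div_eq_mul_inv, div_div]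
      rw [hFk, norm_mul, hre]
      calc Real.exp (u.re * L * k - ε * Real.exp (L * k)) * Φ
          ≤ Real.exp (u.re * L * k) * (D * Real.exp (-(N * (L * max (k : ℝ) 0)))) := by
            gcongr
            have : 0 < ε * Real.exp (L * k) := by positivity
            linarith
        _ = D * Real.exp (u.re * L * k - N * (L * max (k : ℝ) 0)) := by
            rw [sub_eq_add_neg, Real.exp_add]; ring
        _ ≤ D * Real.exp (-(u.re * L * |(k : ℝ)|)) := by
            gcongr
            rcases le_total (k : ℝ) 0 with hk0 | hk0
            · rw [max_eq_right hk0, abs_of_nonpos hk0]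
              linarith
            · rw [max_eq_left hk0, abs_of_nonneg hk0]
              have : 0 ≤ L * k := by positivity
              nlinarith
    have hdiff := hsum.sub (hasSum_ite_eq (m : ℤ) (∫ x, F m x))
    have hle := hdiff.norm_le_of_bounded (hS.hasSum.mul_left D) (fun k => by
      by_cases hk : k = m
      · rw [if_pos hk, hk, sub_self, norm_zero]
        positivity
      · rw [if_neg hk, sub_zero]
        exact hFle k hk)
    rw [← hFm]
    have := norm_sub_norm_le (∫ x, F m x) (∫ x, ∑' k, F k x)
    rw [norm_sub_rev] at this
    linarith
  have ht1 : Tendsto (fun m : ℕ => Real.exp (-(L * m))) atTop (𝓝 0) :=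
    Real.tendsto_exp_neg_atTop_nhds_zero.comp
      (tendsto_natCast_atTop_atTop.const_mul_atTop hL)
  have ht2 : Tendsto (fun m : ℕ => Real.exp (u.re * L * m - 1) * c) atTop atTop :=
    (Real.tendsto_exp_atTop.comp (tendsto_atTop_add_const_right _ (-1)
      (tendsto_natCast_atTop_atTop.const_mul_atTop (mul_pos hu hL)))).atTop_mul_const hc
  obtain ⟨m, h1, h2⟩ := ((ht1.eventually (gt_mem_nhds (half_pos hδ))).and
    (ht2.eventually_gt_atTop (M * c + D * S))).exists
  exact (key m h1).not_gt h2

/-! ### Poisson summation: from the lacunary series to the Gamma series -/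

open MeasureTheory Set in
theorem setIntegral_Ioi_zero_eq_integral_comp_exp_mul {L : ℝ} (hL : 0 < L) (f : ℝ → ℂ) :
    ∫ t in Ioi (0 : ℝ), f t = ∫ s : ℝ, (L * Real.exp (L * s)) • f (Real.exp (L * s)) := by
  have himg : (fun s : ℝ => Real.exp (L * s)) '' univ = Ioi 0 := by
    rw [image_univ, ← Real.range_exp]
    exact (mul_left_surjective₀ hL.ne').range_comp Real.exp
  rw [← himg, integral_image_eq_integral_abs_deriv_smul MeasurableSet.univ
    (f' := fun s => L * Real.exp (L * s)) ?_ ?_, setIntegral_univ]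
  · refine integral_congr_ae (Eventually.of_forall fun s => ?_)
    dsimp only
    rw [abs_of_pos (by positivity)]
  · intro s _
    have := ((hasDerivAt_id s).const_mul L).exp
    rw [mul_one, mul_comm] at this
    exact this.hasDerivWithinAt
  · exact fun a _ b _ hab => mul_left_cancel₀ hL.ne' (Real.exp_injective hab)

/-- The substitution `t = exp (L s)` turns the Fourier integral into the Gamma integral with
exponent `u - 2πix/L`. -/
theorem fourier_exp_sub_mul_exp {u w : ℂ} (hu : 0 < u.re) (hw : 0 < w.re) {L : ℝ} (hL : 0 < L)
    (x : ℝ) :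
    FourierTransform.fourier
        (fun s : ℝ => Complex.exp (u * L * s - w * Real.exp (L * s))) x =
      (L : ℂ)⁻¹ * (Complex.Gamma (u - 2 * Real.pi * x / L * Complex.I) *
        Complex.exp (-((u - 2 * Real.pi * x / L * Complex.I) * Complex.log w))) := by
  set a : ℂ := u - 2 * Real.pi * x / L * Complex.I with ha
  have hare : 0 < a.re := by
    rw [ha, show (2 * Real.pi * x / L : ℂ) = ((2 * Real.pi * x / L : ℝ) : ℂ) by push_cast; ring]
    simpa using hu
  have hL0 : (L : ℂ) ≠ 0 := by exact_mod_cast hL.ne'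
  rw [mul_comm (Complex.Gamma a), ← integral_cpow_mul_cexp_neg_mul hare hw,
    setIntegral_Ioi_zero_eq_integral_comp_exp_mul hL, ← MeasureTheory.integral_const_mul,
    Real.fourier_real_eq_integral_exp_smul]
  refine MeasureTheory.integral_congr_ae (Eventually.of_forall fun s => ?_)
  dsimp only
  rw [Complex.real_smul, smul_eq_mul, Complex.ofReal_mul L, mul_assoc (L : ℂ),
    inv_mul_cancel_left₀ hL0,
    Complex.cpow_def_of_ne_zero (by exact_mod_cast (Real.exp_pos _).ne'),
    ← Complex.ofReal_log (Real.exp_pos _).le, Real.log_exp, ← Complex.exp_add]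
  nth_rewrite 2 [Complex.ofReal_exp]
  rw [← Complex.exp_add, ← Complex.exp_add]
  congr 1
  rw [ha]
  push_cast
  field_simp
  ring

theorem tsum_exp_sub_mul_exp_eq {u w : ℂ} (hu : 0 < u.re) (hw : 0 < w.re) {L : ℝ} (hL : 0 < L)
    (hs : Summable fun n : ℤ => (L : ℂ)⁻¹ * (Complex.Gamma (u - 2 * Real.pi * n / L * Complex.I) *
        Complex.exp (-((u - 2 * Real.pi * n / L * Complex.I) * Complex.log w)))) :
    ∑' k : ℤ, Complex.exp (u * L * k - w * Real.exp (L * k)) =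
      ∑' n : ℤ, (L : ℂ)⁻¹ * (Complex.Gamma (u - 2 * Real.pi * n / L * Complex.I) *
        Complex.exp (-((u - 2 * Real.pi * n / L * Complex.I) * Complex.log w))) := by
  set g : ℝ → ℂ := fun s => Complex.exp (u * L * s - w * Real.exp (L * s)) with hg
  have hF : ∀ n : ℤ, FourierTransform.fourier g n = (L : ℂ)⁻¹ *
      (Complex.Gamma (u - 2 * Real.pi * n / L * Complex.I) *
        Complex.exp (-((u - 2 * Real.pi * n / L * Complex.I) * Complex.log w))) := fun n => by
    have h := fourier_exp_sub_mul_exp hu hw hL n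
    rwa [Complex.ofReal_intCast] at h
  obtain ⟨K, hK0, hK⟩ := exp_sub_mul_exp_le (σ := u.re) hw
  have hnorm : ∀ s, ‖g s‖ ≤ K * Real.exp (-(u.re * L * |s|)) := fun s => by
    have h1 := hK (L * s)
    rw [abs_mul, abs_of_pos hL, ← mul_assoc, ← mul_assoc] at h1
    refine le_trans (le_of_eq ?_) h1
    rw [hg, Complex.norm_exp, Complex.sub_re, Complex.re_mul_ofReal, Complex.re_mul_ofReal,
      Complex.re_mul_ofReal]
  have hO : g =O[cocompact ℝ] fun x : ℝ => |x| ^ (-2 : ℝ) := by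
    have h1 : g =O[cocompact ℝ] fun s : ℝ => Real.exp (-(u.re * L * |s|)) :=
      Asymptotics.IsBigO.of_bound K (Eventually.of_forall fun s => by
        rw [Real.norm_of_nonneg (Real.exp_pos _).le]; exact hnorm s)
    have h2 : (fun s : ℝ => Real.exp (-(u.re * L * s))) =o[atTop] fun s : ℝ => s ^ (-2 : ℝ) := by
      simpa only [neg_mul] using isLittleO_exp_neg_mul_rpow_atTop (mul_pos hu hL) (-2)
    exact h1.trans (h2.comp_tendsto (tendsto_norm_cocompact_atTop (E := ℝ))).isBigO
  have h := Real.tsum_eq_tsum_fourier_of_rpow_decay_of_summable (f := g) (by fun_prop)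
    one_lt_two hO (by simpa only [hF] using hs) 0
  simp only [hF, zero_add] at h
  simpa [hg] using h

/-- The bilateral series `∑ Γ(u + 2ivn/π) z ^ n` in terms of two power series. -/
theorem hasSum_bilateral {u : ℂ} (hu : 0 < u.re) {v : ℝ} (hv : v ≠ 0) {z : ℂ}
    (hz : z ∈ Metric.ball (0 : ℂ) (Real.exp |v|)) (hz' : z⁻¹ ∈ Metric.ball (0 : ℂ) (Real.exp |v|)) :
    HasSum (fun n : ℤ => Complex.Gamma (u + 2 * v / Real.pi * n * Complex.I) * z ^ n)
      (∑' n : ℕ, gammaCoeff u v n * z ^ n + ∑' n : ℕ, gammaCoeff u (-v) n * z⁻¹ ^ n -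
        Complex.Gamma u) := by
  have h1 := ((coeffBound_gammaCoeff_of_re_pos hu hv).summable_ball hz).hasSum
  have h2 := ((coeffBound_gammaCoeff_of_re_pos (v := -v) hu (neg_ne_zero.2 hv)).summable_ball
    (by rwa [abs_neg])).hasSum
  -- Both halves contain the index `0`, hence the subtracted `Γ(u)`.
  have h := HasSum.of_nat_of_neg
    (f := fun n : ℤ => Complex.Gamma (u + 2 * v / Real.pi * n * Complex.I) * z ^ n)
    (h1.congr_fun fun n => ?_) (h2.congr_fun fun n => ?_)
  · simpa using h
  · rw [gammaCoeff, gammaCoeff_arg]; simp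
  · rw [gammaCoeff, gammaCoeff_arg]; simp [neg_div]

/-- The period is `L = π² / |v|` because then `2π / L = 2|v| / π`, the spacing of the Gamma
arguments. -/
theorem tsum_exp_sub_mul_exp_eq_powerSeries {u : ℂ} (hu : 0 < u.re) {v : ℝ} (hv : v ≠ 0) {w : ℂ}
    (hw : 0 < w.re) {z : ℂ}
    (hzw : z = Complex.exp (-(2 * v / Real.pi * Complex.I * Complex.log w)))
    (hz : z ∈ Metric.ball (0 : ℂ) (Real.exp |v|))
    (hz' : z⁻¹ ∈ Metric.ball (0 : ℂ) (Real.exp |v|)) :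
    ∑' k : ℤ, Complex.exp (u * (Real.pi ^ 2 / |v| : ℝ) * k -
        w * Real.exp (Real.pi ^ 2 / |v| * k)) =
      (|v| / Real.pi ^ 2 : ℝ) * Complex.exp (-(u * Complex.log w)) *
      (∑' n : ℕ, gammaCoeff u v n * z ^ n + ∑' n : ℕ, gammaCoeff u (-v) n * z⁻¹ ^ n -
        Complex.Gamma u) := by
  have hv' : 0 < |v| := abs_pos.2 hv
  have hL : 0 < Real.pi ^ 2 / |v| := by positivity
  have hpi : (Real.pi : ℂ) ≠ 0 := by exact_mod_cast Real.pi_ne_zero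
  set T : ℤ → ℂ := fun n => ((Real.pi ^ 2 / |v| : ℝ) : ℂ)⁻¹ *
    (Complex.Gamma (u - 2 * Real.pi * n / (Real.pi ^ 2 / |v| : ℝ) * Complex.I) *
    Complex.exp (-((u - 2 * Real.pi * n / (Real.pi ^ 2 / |v| : ℝ) * Complex.I) * Complex.log w)))
    with hT
  set s := (|v| / Real.pi ^ 2 : ℝ) * Complex.exp (-(u * Complex.log w)) *
      (∑' n : ℕ, gammaCoeff u v n * z ^ n + ∑' n : ℕ, gammaCoeff u (-v) n * z⁻¹ ^ n -
        Complex.Gamma u) with hs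
  have hB : HasSum (fun n : ℤ => (|v| / Real.pi ^ 2 : ℝ) * Complex.exp (-(u * Complex.log w)) *
      (Complex.Gamma (u + 2 * v / Real.pi * n * Complex.I) * z ^ n)) s :=
    (hasSum_bilateral hu hv hz hz').mul_left _
  -- The relation means `m = n` if `v < 0` and `m = -n` if `v > 0`.
  have hterm : ∀ n m : ℤ, -(|v| * n) = v * m →
      T n = (|v| / Real.pi ^ 2 : ℝ) * Complex.exp (-(u * Complex.log w)) *
      (Complex.Gamma (u + 2 * v / Real.pi * m * Complex.I) * z ^ m) := by
    intro n m hnm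
    have hnm' : -((|v| : ℝ) * (n : ℂ)) = v * m := by exact_mod_cast congrArg Complex.ofReal hnm
    have harg : u - 2 * Real.pi * n / (Real.pi ^ 2 / |v| : ℝ) * Complex.I =
        u + 2 * v / Real.pi * m * Complex.I := by
      have hv0 : ((|v| : ℝ) : ℂ) ≠ 0 := by exact_mod_cast hv'.ne'
      push_cast
      field_simp
      linear_combination 2 * Complex.I * hnm'
    simp only [hT]
    rw [harg, hzw, ← Complex.exp_int_mul, ← Complex.ofReal_inv, inv_div, mul_assoc, mul_assoc,
      mul_left_comm (Complex.exp _), ← Complex.exp_add]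
    ring_nf
  have hTs : HasSum T s := by
    rcases lt_or_gt_of_ne hv with h | h
    · exact hB.congr_fun fun n => hterm n n (by rw [abs_of_neg h]; ring)
    · have := (Equiv.neg ℤ).hasSum_iff.2 hB
      exact this.congr_fun fun n => hterm n (-n) (by rw [abs_of_pos h]; push_cast; ring)
  rw [← hTs.tsum_eq]
  exact tsum_exp_sub_mul_exp_eq hu hw hL hTs.summable

/-! ### No point of the circle is regular -/

theorem not_regular_of_re_pos {u : ℂ} (hu : 0 < u.re) {v : ℝ} (hv : v ≠ 0) {ζ : ℂ}
    (hζ : ζ ∈ Metric.sphere (0 : ℂ) (Real.exp |v|)) {g : ℂ → ℂ} (hg : AnalyticAt ℂ g ζ)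
    (hgf : ∀ᶠ z in 𝓝[Metric.ball (0 : ℂ) (Real.exp |v|)] ζ,
      g z = ∑' n : ℕ, gammaCoeff u v n * z ^ n) : False := by
  have hv' : 0 < |v| := abs_pos.2 hv
  have hpi := Real.pi_pos
  have hζn : ‖ζ‖ = Real.exp |v| := mem_sphere_zero_iff_norm.1 hζ
  have hζ0 : ζ ≠ 0 := norm_pos_iff.1 (by rw [hζn]; exact Real.exp_pos _)
  -- `E` solves `exp (-(2iv/π) E) = ζ`. As `log |ζ| = |v|`, its imaginary part is `±π/2`, so `exp E`
  -- lies on the imaginary axis.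
  set E : ℂ := Complex.log ζ * ((Real.pi / (2 * v) : ℝ) : ℂ) * Complex.I with hE
  have hEim : E.im = |v| * (Real.pi / (2 * v)) := by
    rw [hE, Complex.mul_I_im, Complex.re_mul_ofReal, Complex.log_re, hζn, Real.log_exp]
  have hEim' : E.im = Real.pi / 2 ∨ E.im = -(Real.pi / 2) := by
    rw [hEim]
    rcases lt_or_gt_of_ne hv with h | h
    · right
      rw [abs_of_neg h]
      field_simp
    · left
      rw [abs_of_pos h]
      field_simp
  set w₀ := Complex.exp E with hw₀
  have hw₀re : w₀.re = 0 := by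
    rw [hw₀, Complex.exp_re]
    rcases hEim' with h | h <;> simp [h]
  have hw₀im : w₀.im ≠ 0 := fun h => Complex.exp_ne_zero E (Complex.ext hw₀re h)
  have hw₀eq : w₀ = w₀.im * Complex.I := Complex.ext (by simp [hw₀re]) (by simp)
  have hlog : Complex.log w₀ = E := Complex.log_exp
    (by rcases hEim' with h | h <;> rw [h] <;> linarith)
    (by rcases hEim' with h | h <;> rw [h] <;> linarith)
  let Z : ℂ → ℂ := fun w => Complex.exp (-(2 * v / Real.pi * Complex.I * Complex.log w))
  have hlogc : ContinuousAt Complex.log w₀ := continuousAt_clog (Or.inr hw₀im)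
  have hZc : ContinuousAt Z w₀ := by
    show ContinuousAt (fun w => Complex.exp (-(2 * v / Real.pi * Complex.I * Complex.log w))) w₀
    fun_prop
  have hZ₀ : Z w₀ = ζ := by
    simp only [Z]
    rw [hlog, hE]
    have hvC : (v : ℂ) ≠ 0 := by exact_mod_cast hv
    have hpC : (Real.pi : ℂ) ≠ 0 := by exact_mod_cast hpi.ne'
    have : -(2 * (v : ℂ) / Real.pi * Complex.I *
        (Complex.log ζ * ((Real.pi / (2 * v) : ℝ) : ℂ) * Complex.I)) = Complex.log ζ := by
      push_cast
      field_simp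
      rw [Complex.I_sq]
      ring
    rw [this, Complex.exp_log hζ0]
  have hZnorm : ∀ w, ‖Z w‖ = Real.exp (2 * v / Real.pi * Complex.arg w) := fun w => by
    simp only [Z]
    rw [Complex.norm_exp, ← Complex.log_im,
      show (2 * (v : ℂ) / Real.pi * Complex.I * Complex.log w) =
        ((2 * v / Real.pi : ℝ) : ℂ) * (Complex.log w * Complex.I) by push_cast; ring,
      Complex.neg_re, Complex.re_ofReal_mul, Complex.mul_I_re]
    ring_nf
  have habs : ∀ w : ℂ, 0 < w.re → |2 * v / Real.pi * Complex.arg w| < |v| := fun w hw => by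
    have h1 := Complex.abs_arg_lt_pi_div_two_iff.2 (Or.inl hw)
    rw [abs_mul, abs_div, abs_mul, abs_two, abs_of_pos hpi, div_mul_eq_mul_div, div_lt_iff₀ hpi]
    nlinarith
  have hZball : ∀ w : ℂ, 0 < w.re → Z w ∈ Metric.ball (0 : ℂ) (Real.exp |v|) := fun w hw => by
    rw [mem_ball_zero_iff, hZnorm, Real.exp_lt_exp]
    exact (le_abs_self _).trans_lt (habs w hw)
  have hZball' : ∀ w : ℂ, 0 < w.re → (Z w)⁻¹ ∈ Metric.ball (0 : ℂ) (Real.exp |v|) :=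
    fun w hw => by
      rw [mem_ball_zero_iff, norm_inv, hZnorm, ← Real.exp_neg, Real.exp_lt_exp]
      exact (neg_le_abs _).trans_lt (habs w hw)
  let G : ℂ → ℂ := fun z => ∑' n : ℕ, gammaCoeff u (-v) n * z ^ n
  have hGc : ContinuousAt G ζ⁻¹ := by
    refine ((coeffBound_gammaCoeff_of_re_pos hu (neg_ne_zero.2 hv)).analyticOnNhd ζ⁻¹
      ?_).continuousAt
    rw [mem_ball_zero_iff, norm_inv, hζn, abs_neg, ← Real.exp_neg, Real.exp_lt_exp]
    linarith
  -- `Φ` has `g` in place of the power series: it is continuous at `w₀`, and near `w₀` it equals the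
  -- lacunary series on `Re w > 0`.
  let Φ : ℂ → ℂ := fun w => (|v| / Real.pi ^ 2 : ℝ) * Complex.exp (-(u * Complex.log w)) *
    (g (Z w) + G (Z w)⁻¹ - Complex.Gamma u)
  have hgZ : ContinuousAt (fun w => g (Z w)) w₀ :=
    ContinuousAt.comp (by rw [hZ₀]; exact hg.continuousAt) hZc
  have hGZ : ContinuousAt (fun w => G (Z w)⁻¹) w₀ :=
    ContinuousAt.comp (g := G) (f := fun w => (Z w)⁻¹) (by rw [hZ₀]; exact hGc)
      (hZc.inv₀ (by rw [hZ₀]; exact hζ0))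
  have hΦc : ContinuousAt Φ w₀ := by
    have h1 : ContinuousAt (fun w => Complex.exp (-(u * Complex.log w))) w₀ := by fun_prop
    exact (continuousAt_const.mul h1).mul ((hgZ.add hGZ).sub continuousAt_const)
  have hΦb : ∀ᶠ w in 𝓝 w₀, ‖Φ w‖ < ‖Φ w₀‖ + 1 :=
    hΦc.norm.eventually (gt_mem_nhds (lt_add_one _))
  rw [eventually_nhdsWithin_iff, ← hZ₀] at hgf
  obtain ⟨δ, hδ, hball⟩ := Metric.eventually_nhds_iff.1 (hΦb.and (hZc.eventually hgf))
  obtain ⟨w, hw, hwδ, hwM⟩ := exists_lt_norm_tsum_exp_sub_mul_exp hu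
    (L := Real.pi ^ 2 / |v|) (by positivity) w₀.im hδ (‖Φ w₀‖ + 1)
  rw [← hw₀eq, ← dist_eq_norm] at hwδ
  obtain ⟨h1, h2⟩ := hball hwδ
  rw [tsum_exp_sub_mul_exp_eq_powerSeries hu hv hw (z := Z w) rfl (hZball w hw) (hZball' w hw),
    ← h2 (hZball w hw)] at hwM
  exact lt_asymm h1 hwM

theorem AvoidsPoles.not_regular {u : ℂ} {v : ℝ} (hv : v ≠ 0) (hu : AvoidsPoles u v) {ζ : ℂ}
    (hζ : ζ ∈ Metric.sphere (0 : ℂ) (Real.exp |v|)) :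
    ∀ g : ℂ → ℂ, AnalyticAt ℂ g ζ →
      ¬ ∀ᶠ z in 𝓝[Metric.ball (0 : ℂ) (Real.exp |v|)] ζ,
        g z = ∑' n : ℕ, gammaCoeff u v n * z ^ n := by
  refine AvoidsPoles.induction (P := fun u => ∀ g : ℂ → ℂ, AnalyticAt ℂ g ζ →
      ¬ ∀ᶠ z in 𝓝[Metric.ball (0 : ℂ) (Real.exp |v|)] ζ,
        g z = ∑' n : ℕ, gammaCoeff u v n * z ^ n) ?_ ?_ hu
  · exact fun u hu g hg hgf => not_regular_of_re_pos hu hv hζ hg hgf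
  · intro u hu ih g hg hgf
    set d : ℂ := 2 * Complex.I * (v : ℂ) / Real.pi
    refine ih (fun z => u * g z + d * z * deriv g z) (by have := hg.deriv; fun_prop) ?_
    -- Equality near each nearby point of the open disc is needed to equate derivatives there.
    have h1 := eventually_eventually_nhdsWithin.2 hgf
    filter_upwards [h1, hgf, self_mem_nhdsWithin] with z hz hz1 hzb
    rw [Metric.isOpen_ball.nhdsWithin_eq hzb] at hz
    have h2 := Filter.EventuallyEq.deriv_eq (f := fun z => ∑' n : ℕ, gammaCoeff u v n * z ^ n) hz
    rw [h2, hz1, ← (hu.coeffBound hv).tsum_euler u d hzb]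
    exact tsum_congr fun n => by rw [hu.gammaCoeff_add_one]

theorem mainTheorem3 (u : ℂ) (v : ℝ) (hv : v ≠ 0)
    (hu : ∀ m k : ℕ, -u ≠ (m : ℂ) + (2 * Complex.I * (v : ℂ) / (Real.pi : ℂ)) * (k : ℂ)) :
    CircleIsNaturalBoundary
      (fun n : ℕ => Complex.Gamma (u + 2 * Complex.I * (v : ℂ) * (n : ℂ) / (Real.pi : ℂ)))
      (Real.exp |v|) := by
  have h : AvoidsPoles u v := hu
  have hb := h.coeffBound hv
  exact ⟨Real.exp_pos _, fun z hz => hb.summable_ball hz, hb.analyticOnNhd,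
    fun ζ hζ ⟨g, hg, hgf⟩ => h.not_regular hv hζ g hg hgf⟩
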